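/- All rings are commutative with unity. A module is \emph{uniserial} if its submodules are linearly ordered by inclusion; a ring is a \emph{valuation ring} (possibly with zero divisors) if it is uniserial as a module over itself, and a ring $R$ is \emph{arithmetical} if the localization $R_P$ is a valuation ring for every maximal ideal $P$. A ring $A$ is \emph{coherent} if every finitely generated ideal of $A$ is finitely presented, and \emph{semicoherent} if, for all injective $A$-modules $E$ and $F$, the module $\mathrm{Hom}_A(E,F)$ is isomorphic to a submodule of a flat $A$-module. An $R$-module $M$ is \emph{FP-injective} if $\mathrm{Ext}^1_R(F,M)=0$ for every finitely presented $R$-module $F$. Let $\mathrm{E}_R(M)$ denote the injective hull of $M$. The module $M$ has \emph{finite Goldie dimension} if, for some integer $n\ge 0$, $\mathrm{E}_R(M)$ is a direct sum of $n$ indecomposable injective modules. For a ring $A$, let $Q(A)$ denote its total ring of fractions, i.e. its localization at the set of all non-zero-divisors. \textbf{Theorem.} Let $R$ be an arithmetical ring. The following conditions are equivalent: \begin{enumerate} \item for each maximal ideal $P$ of $R$, the ring $R_P$ is either coherent or not semicoherent; \item for each multiplicative subset $S$ of $R$ and each injective $R$-module $G$ of finite Goldie dimension, the $R$-module $S^{-1}G$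 is injective; \item for each multiplicative subset $S$ of $R$ and each FP-injective $R$-module $G$ of finite Goldie dimension, the $R$-module $S^{-1}G$ is FP-injective; \item for each maximal ideal $P$ of $R$, the $R$-module $Q(R_P)\otimes_R \mathrm{E}_R(R/P)$ is FP-injective. \end{enumerate} -/

import Mathlib

universe u

section InjectiveHulls

variable {R : Type u} [CommRing R]

/-- A linear map `f : M → E` exhibits `E` as an injective hull of `M`: `f` is a monomorphism, its
range is an essential submodule of `E`, and `E` is injective. -/
structure IsInjectiveHull {M E : Type u} [AddCommGroup M] [Module R M]
    [AddCommGroup E] [Module R E] (f : M →ₗ[R] E) : Prop where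
  injective_map : Function.Injective f
  essential : ∀ N : Submodule R E, N ⊓ LinearMap.range f = ⊥ → N = ⊥
  injective_module : Module.Injective R E

/-- Inside an injective module, every submodule `A` is contained in an injective submodule in which
it is essential. -/
theorem exists_essential_injective {J : Type u} [AddCommGroup J] [Module R J]
    (hJ : Module.Injective R J) (A : Submodule R J) :
    ∃ H : Submodule R J, A ≤ H ∧ (∀ N : Submodule R J, N ≤ H → N ⊓ A = ⊥ → N = ⊥) ∧
      Module.Injective R H := by
  obtain ⟨H, hAH, hH⟩ := zorn_le_nonempty₀
    {H : Submodule R J | A ≤ H ∧ ∀ N : Submodule R J, N ≤ H → N ⊓ A = ⊥ → N = ⊥} (by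
      intro c hc hchain y hy
      refine ⟨sSup c, ⟨(hc hy).1.trans (le_sSup hy), fun N hN hNA => ?_⟩, fun z hz => le_sSup hz⟩
      rw [eq_bot_iff]
      intro x hx
      obtain ⟨K, hK, hxK⟩ := (Submodule.mem_sSup_of_directed ⟨y, hy⟩ hchain.directedOn).1 (hN hx)
      have h1 : Submodule.span R {x} = ⊥ := by
        refine (hc hK).2 _ ((Submodule.span_singleton_le_iff_mem _ _).2 hxK) ?_
        rw [eq_bot_iff, ← hNA]
        exact inf_le_inf_right _ ((Submodule.span_singleton_le_iff_mem _ _).2 hx)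
      simpa using h1) A ⟨le_rfl, fun N hN hNA => by rwa [inf_eq_left.2 hN] at hNA⟩
  obtain ⟨C, -, hC⟩ := zorn_le_nonempty₀ {C : Submodule R J | C ⊓ H = ⊥} (by
      intro c hc hchain y hy
      refine ⟨sSup c, ?_, fun z hz => le_sSup hz⟩
      rw [Set.mem_ofPred_eq, eq_bot_iff]
      rintro x ⟨hx, hxH⟩
      obtain ⟨K, hK, hxK⟩ := (Submodule.mem_sSup_of_directed ⟨y, hy⟩ hchain.directedOn).1 hx
      rw [← show K ⊓ H = ⊥ from hc hK]
      exact ⟨hxK, hxH⟩) ⊥ (by simp)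
  have hCH : ∀ x, x ∈ C → x ∈ H → x = 0 := fun x h1 h2 => by
    have : x ∈ C ⊓ H := ⟨h1, h2⟩
    rwa [show C ⊓ H = ⊥ from hC.prop, Submodule.mem_bot] at this
  have hq : ∀ N : Submodule R (J ⧸ C), (∀ h ∈ H, C.mkQ h ∈ N → h = 0) → N = ⊥ := by
    intro N hN
    have h1 : C ≤ N.comap C.mkQ := fun x hx => by
      rw [Submodule.mem_comap, Submodule.mkQ_apply, (Submodule.Quotient.mk_eq_zero C).2 hx]
      exact N.zero_mem
    have h2 : N.comap C.mkQ ≤ C := hC.le_of_ge (by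
      rw [Set.mem_ofPred_eq, eq_bot_iff]
      rintro x ⟨hx, hxH⟩
      exact hN x hxH hx) h1
    rw [eq_bot_iff]
    intro y hy
    obtain ⟨x, rfl⟩ := C.mkQ_surjective y
    exact (Submodule.Quotient.mk_eq_zero C).2 (h2 hy)
  obtain ⟨g, hg⟩ := hJ.out (C.mkQ ∘ₗ H.subtype) (by
    rw [← LinearMap.ker_eq_bot, eq_bot_iff]
    intro x hx
    exact Subtype.ext (hCH x ((Submodule.Quotient.mk_eq_zero C).1 hx) x.2)) H.subtype
  have hg' : ∀ h ∈ H, g (C.mkQ h) = h := fun h hh => hg ⟨h, hh⟩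
  have hrange : LinearMap.range g ≤ H := by
    refine hH.le_of_ge ⟨fun a ha => ⟨_, hg' a (hAH ha)⟩, fun K hK hKA => ?_⟩
      fun a ha => ⟨_, hg' a ha⟩
    have hKH : K ⊓ H = ⊥ := hH.prop.2 _ inf_le_right (by
      rw [eq_bot_iff, ← hKA]
      exact inf_le_inf_right _ inf_le_left)
    have hcomap : K.comap g = ⊥ := hq _ fun h hh hmem => by
      have : h ∈ K ⊓ H := ⟨by rw [Submodule.mem_comap, hg' h hh] at hmem; exact hmem, hh⟩
      rwa [hKH, Submodule.mem_bot] at this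
    rw [← Submodule.map_comap_eq_self hK, hcomap, Submodule.map_bot]
  refine ⟨H, hAH, hH.prop.2, ⟨fun X Y _ _ _ _ f hf k => ?_⟩⟩
  obtain ⟨h, hh⟩ := hJ.out f hf (H.subtype ∘ₗ k)
  refine ⟨(g ∘ₗ C.mkQ ∘ₗ h).codRestrict H fun y => hrange ⟨_, rfl⟩, fun x => Subtype.ext ?_⟩
  change g (C.mkQ (h (f x))) = k x
  rw [hh x]
  exact hg' _ (k x).2

theorem exists_isInjectiveHull (M : Type u) [AddCommGroup M] [Module R M] :
    ∃ (E : ModuleCat.{u} R) (f : M →ₗ[R] E), IsInjectiveHull f := by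
  obtain ⟨⟨J, hJ, i, hi⟩⟩ := CategoryTheory.EnoughInjectives.presentation (ModuleCat.of R M)
  have hJ' : Module.Injective R J := Module.injective_module_of_injective_object R J
  have hi' : Function.Injective i.hom := (ModuleCat.mono_iff_injective i).1 hi
  obtain ⟨H, hAH, hess, hinj⟩ := exists_essential_injective hJ' (LinearMap.range i.hom)
  refine ⟨ModuleCat.of R H, i.hom.codRestrict H fun x => hAH ⟨x, rfl⟩, ⟨?_, ?_, hinj⟩⟩
  · intro x y hxy
    exact hi' (congrArg Subtype.val hxy)
  · intro N hN
    have h1 : N.map H.subtype = ⊥ := by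
      refine hess _ (H.map_subtype_le N) ?_
      rw [eq_bot_iff]
      rintro _ ⟨⟨y, hy, rfl⟩, ⟨x, hx⟩⟩
      have h2 : y ∈ N ⊓ LinearMap.range (i.hom.codRestrict H fun x => hAH ⟨x, rfl⟩) :=
        ⟨hy, ⟨x, Subtype.ext hx⟩⟩
      rw [hN, Submodule.mem_bot] at h2
      simp [h2]
    exact Submodule.map_injective_of_injective H.subtype_injective (h1.trans (Submodule.map_bot _).symm)

end InjectiveHulls

section Modules

variable (R : Type u) [CommRing R] (M : Type u) [AddCommGroup M] [Module R M]

/-- The injective hull `E_R(M)` of the `R`-module `M`. -/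
noncomputable def InjectiveHull : Type u :=
  ((exists_isInjectiveHull (R := R) M).choose : ModuleCat.{u} R)

noncomputable instance : AddCommGroup (InjectiveHull R M) :=
  inferInstanceAs (AddCommGroup ((exists_isInjectiveHull (R := R) M).choose : ModuleCat.{u} R))

noncomputable instance : Module R (InjectiveHull R M) :=
  inferInstanceAs (Module R ((exists_isInjectiveHull (R := R) M).choose : ModuleCat.{u} R))

/-- The embedding of a module into its injective hull. -/
noncomputable def InjectiveHull.ι : M →ₗ[R] InjectiveHull R M :=
  (exists_isInjectiveHull (R := R) M).choose_spec.choose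

theorem InjectiveHull.isInjectiveHull : IsInjectiveHull (InjectiveHull.ι R M) :=
  (exists_isInjectiveHull (R := R) M).choose_spec.choose_spec

/-- A module is indecomposable if it is nonzero and is not the direct sum of two nonzero
submodules. -/
def IsIndecomposableModule : Prop :=
  Nontrivial M ∧ ∀ A B : Submodule R M, IsCompl A B → A = ⊥ ∨ B = ⊥

/-- `M` has Goldie dimension `n`: its injective hull is a direct sum of `n` indecomposable
injective modules. -/
def HasGoldieDimension (n : ℕ) : Prop :=
  ∃ D : Fin n → Submodule R (InjectiveHull R M), DirectSum.IsInternal D ∧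
    ∀ i, Module.Injective R (D i) ∧ IsIndecomposableModule R (D i)

/-- `M` has finite Goldie dimension. -/
def HasFiniteGoldieDimension : Prop :=
  ∃ n : ℕ, HasGoldieDimension R M n

/-- `M` is FP-injective: `Ext¹_R(F, M) = 0` for every finitely presented `R`-module `F`. -/
def IsFPInjective : Prop :=
  ∀ (F : Type u) [AddCommGroup F] [Module R F], Module.FinitePresentation R F →
    Subsingleton (CategoryTheory.Abelian.Ext (ModuleCat.of R F) (ModuleCat.of R M) 1)

/-- A module is uniserial if its submodules are linearly ordered by inclusion. -/
def IsUniserialModule : Prop :=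
  ∀ A B : Submodule R M, A ≤ B ∨ B ≤ A

end Modules

section Rings

variable (R : Type u) [CommRing R]

/-- A valuation ring, possibly with zero divisors: a ring that is uniserial as a module over
itself. -/
def IsUniserialRing : Prop :=
  IsUniserialModule R R

/-- A ring is arithmetical if its localization at every maximal ideal is a valuation ring
(possibly with zero divisors). -/
def IsArithmeticalRing : Prop :=
  ∀ (P : Ideal R) [P.IsMaximal], IsUniserialRing (Localization.AtPrime P)

/-- A ring is coherent if each of its finitely generated ideals is finitely presented. -/
def IsCoherentCommRing : Prop :=
  ∀ I : Ideal R, I.FG → Module.FinitePresentation R I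

/-- A ring is semicoherent if for all injective modules `E`, `F` the module `Hom_R(E, F)` embeds
into a flat module. -/
def IsSemicoherentRing : Prop :=
  ∀ (E F : Type u) [AddCommGroup E] [Module R E] [AddCommGroup F] [Module R F],
    Module.Injective R E → Module.Injective R F →
      ∃ (X : Type u) (_ : AddCommGroup X) (_ : Module R X), Module.Flat R X ∧
        ∃ φ : (E →ₗ[R] F) →ₗ[R] X, Function.Injective φ

end Rings

/-!
Everything reduces to a valuation ring `V` (with zero divisors allowed). An indecomposable
injective `R`-module `D` is uniform, so the elements of `R` acting non-injectively on it form a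
proper ideal; if `P` is a maximal ideal containing it, `D` is a module over `V = R_P`
(`IsIndecomposableModule.injective_localizedModule`). A module of finite Goldie dimension is handled
one indecomposable summand of its injective hull at a time.

Over `V`, let `G` be injective and `M = S⁻¹G`. Two facts are combined. First, `M` is injective as
soon as homomorphisms from principal ideals into it extend (`injective_of_isPrincipallyInjective`):
a homomorphism `I → M` from an ideal which is not principal up to `S` can be corrected so that it
lifts to `G`. Second, principal injectivity of `M` asks for a common denominator `u ∈ S` killing
`ann(r) z`, given that each element of `ann(r) z` vanishes in `M`. This is clear if `ann(r)` is
finitely generated, that is, if `V` is coherent. It is also clear unless `S` consists, up to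
saturation, of all non-zero-divisors of `V`. In this last case it suffices that `ann(r)`, for
`r ≠ 0`, is never principal over the total ring of fractions `Q` of `V`
(`injective_of_isLocalizedModule`).

The semicoherence of `V` governs exactly this. If `ann(r)` is principal over `Q` for a single
`r ≠ 0`, then every element of `Q` has an annihilator partner, injective `Q`-modules are flat, and
`Hom(E, F)` embeds into one of them (`isSemicoherentRing_of_annihilator`). Conversely, over a
semicoherent `V` all elements have annihilator partners in `Q`
(`IsSemicoherentRing.exists_annihilator_eq`), and if moreover there are nonzero zero divisors and
non-units which are not zero divisors, then `Q ⊗ E(R/P)` is not principally injective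
(`isCoherentCommRing_of_isPrincipallyInjective`).

Passing from injective to FP-injective modules is a matter of purity: an FP-injective `G` is pure
in its injective hull `E`, so `S⁻¹G` is pure in `S⁻¹E` (`IsFPInjective.localizedModule`). Finally
`Q(R_P) ⊗ E(R/P)` is the localization of `E(R/P)` at the elements of `R` which are not zero divisors
in `R_P`, and `E(R/P)` is indecomposable.
-/

/-! ### FP-injective and principally injective modules -/

section Extension

open CategoryTheory Abelian

variable {R : Type u} [CommRing R] {M : Type u} [AddCommGroup M] [Module R M]

/-- A module is principally injective if homomorphisms into it from principal ideals extend to the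
ring; the condition is written out on elements: `x` is divisible by `r` as soon as the annihilator
of `r` kills `x`. -/
def IsPrincipallyInjective (R : Type u) [CommRing R] (M : Type u) [AddCommGroup M] [Module R M] :
    Prop :=
  ∀ (r : R) (x : M), (∀ a : R, a * r = 0 → a • x = 0) → ∃ y : M, r • y = x

theorem IsFPInjective.exists_extend (hM : IsFPInjective R M) {X Y : Type u} [AddCommGroup X]
    [Module R X] [AddCommGroup Y] [Module R Y] [Module.Finite R X] [Module.Finite R Y]
    [Module.Projective R Y] (i : X →ₗ[R] Y) (hi : Function.Injective i) (g : X →ₗ[R] M) :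
    ∃ h : Y →ₗ[R] M, h ∘ₗ i = g := by
  let S := ModuleCat.shortComplexOfCompEqZero i (LinearMap.range i).mkQ (by ext x; simp)
  have hS : S.ShortExact := ModuleCat.shortComplex_shortExact S
    (by
      intro y
      change (LinearMap.range i).mkQ y = 0 ↔ y ∈ Set.range i
      rw [Submodule.mkQ_apply, Submodule.Quotient.mk_eq_zero]
      rfl) hi (Submodule.mkQ_surjective _)
  have : Module.FinitePresentation R Y := Module.finitePresentation_of_projective R Y
  have hF : Module.FinitePresentation R (Y ⧸ LinearMap.range i) :=
    Module.finitePresentation_of_surjective _ (Submodule.mkQ_surjective _) (by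
      rw [Submodule.ker_mkQ, LinearMap.range_eq_map]
      exact Module.Finite.fg_top.map i)
  have := hM _ hF
  obtain ⟨x₂, hx₂⟩ := Ext.contravariant_sequence_exact₁ hS (ModuleCat.of R M)
    (Ext.mk₀ (ModuleCat.ofHom g)) (n₁ := 1) rfl (Subsingleton.elim _ _)
  obtain ⟨h, rfl⟩ := (Ext.mk₀_bijective _ _).2 x₂
  rw [Ext.mk₀_comp_mk₀] at hx₂
  have := (Ext.mk₀_bijective _ _).1 hx₂
  exact ⟨h.hom, congrArg ModuleCat.Hom.hom this⟩

theorem isFPInjective_of_exists_extend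
    (hM : ∀ (n : ℕ) (K : Submodule R (Fin n → R)), K.FG → ∀ g : K →ₗ[R] M,
      ∃ h : (Fin n → R) →ₗ[R] M, h ∘ₗ K.subtype = g) : IsFPInjective R M := by
  intro F _ _ hF
  obtain ⟨n, K, e, hK⟩ := Module.FinitePresentation.exists_fin R F
  let p : (Fin n → R) →ₗ[R] F := e.symm.toLinearMap ∘ₗ K.mkQ
  let S := ModuleCat.shortComplexOfCompEqZero K.subtype p (by
    ext x
    simp [p])
  have hS : S.ShortExact := ModuleCat.shortComplex_shortExact S
    (by
      intro y
      change e.symm (K.mkQ y) = 0 ↔ y ∈ Set.range K.subtype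
      rw [LinearEquiv.map_eq_zero_iff, Submodule.mkQ_apply, Submodule.Quotient.mk_eq_zero]
      simp) K.subtype_injective (e.symm.surjective.comp K.mkQ_surjective)
  refine subsingleton_of_forall_eq 0 fun x₃ => ?_
  have : Projective S.X₂ := (IsProjective.iff_projective (R := R) (Fin n → R)).1 inferInstance
  obtain ⟨x₁, hx₁⟩ := Ext.contravariant_sequence_exact₃ hS (ModuleCat.of R M) x₃
    (Ext.eq_zero_of_projective _) (n₀ := 0) rfl
  obtain ⟨g, rfl⟩ := (Ext.mk₀_bijective _ _).2 x₁
  obtain ⟨h, hh⟩ := hM n K hK g.hom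
  have : g = S.f ≫ ModuleCat.ofHom h := by
    ext x
    exact (LinearMap.congr_fun hh x).symm
  rw [← hx₁, this, ← Ext.mk₀_comp_mk₀, hS.extClass_comp_assoc]

theorem IsFPInjective.of_injective (hM : Module.Injective R M) : IsFPInjective R M :=
  isFPInjective_of_exists_extend fun _ K _ g =>
    let ⟨h, hh⟩ := hM.out K.subtype K.subtype_injective g
    ⟨h, LinearMap.ext hh⟩

theorem IsFPInjective.of_linearEquiv {N : Type u} [AddCommGroup N] [Module R N] (e : M ≃ₗ[R] N)
    (hM : IsFPInjective R M) : IsFPInjective R N :=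
  isFPInjective_of_exists_extend fun n K hK g => by
    have := Module.Finite.iff_fg.2 hK
    obtain ⟨h, hh⟩ := hM.exists_extend K.subtype K.subtype_injective (e.symm.toLinearMap ∘ₗ g)
    refine ⟨e.toLinearMap ∘ₗ h, LinearMap.ext fun x => ?_⟩
    have := LinearMap.congr_fun hh x
    simp only [LinearMap.comp_apply, LinearEquiv.coe_coe] at this ⊢
    rw [this, e.apply_symm_apply]

theorem injective_of_linearEquiv {N : Type u} [AddCommGroup N] [Module R N] (e : M ≃ₗ[R] N)
    (hM : Module.Injective R M) : Module.Injective R N :=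
  ((Module.Baer.of_injective hM).of_equiv e).injective

theorem IsFPInjective.isPrincipallyInjective (hM : IsFPInjective R M) :
    IsPrincipallyInjective R M := by
  intro r x hx
  let K := LinearMap.ker (LinearMap.toSpanSingleton R R r)
  let i : (R ⧸ K) →ₗ[R] R := K.liftQ (LinearMap.toSpanSingleton R R r) le_rfl
  have hi : Function.Injective i := LinearMap.ker_eq_bot.1 (K.ker_liftQ_eq_bot _ _ le_rfl)
  obtain ⟨h, hh⟩ := hM.exists_extend i hi
    (K.liftQ (LinearMap.toSpanSingleton R M x) fun a ha => by
      simpa using hx a (by simpa [K] using ha))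
  refine ⟨h 1, ?_⟩
  have := LinearMap.congr_fun hh (K.mkQ 1)
  simp only [i, LinearMap.comp_apply, Submodule.mkQ_apply, Submodule.liftQ_apply,
    LinearMap.toSpanSingleton_apply, one_smul] at this
  rw [← map_smul, smul_eq_mul, mul_one, this]

/-- Solving linear systems with constants in a submodule `G`: if `G` is FP-injective, a finite
system solvable in an overmodule `E` is solvable in `G`. -/
theorem IsFPInjective.exists_solution (hM : IsFPInjective R M) {E : Type u} [AddCommGroup E]
    [Module R E] (j : M →ₗ[R] E) (hj : Function.Injective j) {n : ℕ} {ι : Type*} [Finite ι]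
    (k : ι → Fin n → R) (c : ι → M) (y : (Fin n → R) →ₗ[R] E) (hy : ∀ i, y (k i) = j (c i)) :
    ∃ z : (Fin n → R) →ₗ[R] M, ∀ i, z (k i) = c i := by
  let K := Submodule.span R (Set.range k)
  have hK : ∀ v : K, y v ∈ LinearMap.range j := fun v => by
    have : K ≤ (LinearMap.range j).comap y := by
      rw [Submodule.span_le]
      rintro _ ⟨i, rfl⟩
      exact ⟨c i, (hy i).symm⟩
    exact this v.2
  let e := LinearEquiv.ofInjective j hj
  let g : K →ₗ[R] M := e.symm.toLinearMap ∘ₗ (y ∘ₗ K.subtype).codRestrict _ hK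
  have : Module.Finite R K := Module.Finite.iff_fg.2 (Submodule.fg_span (Set.finite_range k))
  obtain ⟨z, hz⟩ := hM.exists_extend K.subtype K.subtype_injective g
  refine ⟨z, fun i => ?_⟩
  have := LinearMap.congr_fun hz ⟨k i, Submodule.subset_span ⟨i, rfl⟩⟩
  refine this.trans (hj ?_)
  have h2 : j (e.symm ⟨y (k i), hK ⟨k i, Submodule.subset_span ⟨i, rfl⟩⟩⟩) = y (k i) :=
    congrArg Subtype.val (e.apply_symm_apply _)
  exact h2.trans (hy i)

end Extension
/-! ### Localizations of injective modules over valuation rings -/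

section Localization

variable {V : Type u} [CommRing V] [PreValuationRing V]

theorem PreValuationRing.exists_eq_span_singleton {I : Ideal V} (hI : I.FG) :
    ∃ r : V, I = Ideal.span {r} := by
  induction I, hI using Submodule.fg_induction with
  | singleton x => exact ⟨x, rfl⟩
  | sup N₁ N₂ _ _ h₁ h₂ =>
    obtain ⟨a, rfl⟩ := h₁
    obtain ⟨b, rfl⟩ := h₂
    rcases ValuationRing.dvd_total a b with h | h
    · exact ⟨a, sup_eq_left.2 (Ideal.span_singleton_le_span_singleton.2 h)⟩
    · exact ⟨b, sup_eq_right.2 (Ideal.span_singleton_le_span_singleton.2 h)⟩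

variable {S : Submonoid V} {G M : Type u} [AddCommGroup G] [Module V G] [AddCommGroup M]
  [Module V M]

theorem PreValuationRing.dvd_of_forall_not_dvd {c s : V} (hc : ∀ s ∈ S, ¬ c ∣ s) (hs : s ∈ S) :
    s ∣ c :=
  (ValuationRing.dvd_total s c).resolve_right (hc s hs)

/-- If `r₀` survives in `S⁻¹V`, then every element of `S⁻¹G` killed by `r₀` has a representative
in `G` without denominator. -/
theorem exists_apply_eq_of_smul_eq_zero (hG : IsPrincipallyInjective V G) (f : G →ₗ[V] M)
    [IsLocalizedModule S f] {r₀ : V} (hr₀ : ∀ s ∈ S, s * r₀ ≠ 0) {y : M} (hy : r₀ • y = 0) :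
    ∃ z, f z = y := by
  obtain ⟨⟨z, s⟩, hz⟩ := IsLocalizedModule.surj S f y
  have hz' : (s : V) • y = f z := hz
  have h0 : f (r₀ • z) = 0 := by
    rw [map_smul, ← hz', smul_comm, hy, smul_zero]
  obtain ⟨u, hu⟩ := (IsLocalizedModule.eq_zero_iff S f).1 h0
  have hu' : (u : V) • r₀ • z = 0 := hu
  obtain ⟨z', hz'1⟩ := hG (s * u) ((u : V) • z) (by
    intro b hb
    rcases ValuationRing.dvd_total r₀ b with ⟨b', rfl⟩ | ⟨b', rfl⟩
    · rw [mul_comm, mul_smul, smul_comm r₀, hu', smul_zero]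
    · exact absurd (by linear_combination b' * hb) (hr₀ (s * u) (S.mul_mem s.2 u.2)))
  refine ⟨z', IsLocalizedModule.smul_injective f (s * u) ?_⟩
  change ((s : V) * u) • f z' = ((s : V) * u) • y
  rw [← map_smul, hz'1, map_smul, ← hz', smul_smul, mul_comm]

/-- If no element of the ideal `I` generates it up to `S`, a homomorphism `g : I → S⁻¹G` that is
locally multiplication by elements of `G` lifts to `G`: on `r = c r'`, where `c` is divisible by
all of `S` and `g r' = r' z`, the lift is `r z`, which does not depend on the choices. -/
theorem exists_lift_of_forall_not_dvd (f : G →ₗ[V] M) [IsLocalizedModule S f] {I : Ideal V}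
    (hI : ∀ r ∈ I, ∃ r' ∈ I, ∀ s ∈ S, ¬ r ∣ s * r') (g : I →ₗ[V] M)
    (hg : ∀ r : I, ∃ z : G, f ((r : V) • z) = g r) : ∃ h : I →ₗ[V] G, f ∘ₗ h = g := by
  choose Z hZ using hg
  have hI' : ∀ r : I, ∃ r' : I, ∃ c : V, (∀ s ∈ S, ¬ c ∣ s) ∧ (r : V) = c * r' := by
    rintro ⟨r, hr⟩
    obtain ⟨r', hr', h⟩ := hI r hr
    obtain ⟨c, hc⟩ := (ValuationRing.dvd_total r' r).resolve_right fun h1 =>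
      h 1 S.one_mem (by simpa using h1)
    refine ⟨⟨r', hr'⟩, c, ?_, hc.trans (mul_comm _ _)⟩
    rintro _ hs ⟨x, rfl⟩
    exact h _ hs ⟨x, by rw [hc]; ring⟩
  choose ρ c hc hρ using hI'
  have key : ∀ (r σ : I), (σ : V) ∣ ρ r → (r : V) • Z (ρ r) = (r : V) • Z σ := by
    rintro r σ ⟨d, hd⟩
    have h1 : f ((ρ r : V) • Z (ρ r)) = f ((ρ r : V) • Z σ) := by
      have h2 : ρ r = d • σ := Subtype.ext (by rw [hd]; exact mul_comm _ _)
      rw [hZ, h2, map_smul, ← hZ σ, ← map_smul, smul_smul]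
      rfl
    obtain ⟨u, hu⟩ := (IsLocalizedModule.eq_iff_exists S f).1 h1
    have hu' : (u : V) • (ρ r : V) • Z (ρ r) = (u : V) • (ρ r : V) • Z σ := hu
    obtain ⟨e, he⟩ := PreValuationRing.dvd_of_forall_not_dvd (hc r) u.2
    have h3 : (r : V) = e * (u * ρ r) := by rw [hρ r, he]; ring
    rw [h3, mul_smul, mul_smul, mul_smul, mul_smul, hu']
  have total : ∀ σ τ : I, ∃ υ : I, (υ : V) ∣ σ ∧ (υ : V) ∣ τ := fun σ τ =>
    (ValuationRing.dvd_total (σ : V) τ).elim (fun h => ⟨σ, dvd_rfl, h⟩) fun h => ⟨τ, h, dvd_rfl⟩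
  refine ⟨{ toFun := fun r => (r : V) • Z (ρ r), map_add' := ?_, map_smul' := ?_ }, ?_⟩
  · intro r₁ r₂
    obtain ⟨σ, h1, h2⟩ := total (ρ r₁) (ρ r₂)
    obtain ⟨τ, h3, h4⟩ := total σ (ρ (r₁ + r₂))
    rw [key _ τ (h3.trans h1), key _ τ (h3.trans h2), key _ τ h4, ← add_smul]
    rfl
  · intro a r
    obtain ⟨σ, h1, h2⟩ := total (ρ r) (ρ (a • r))
    rw [key _ σ h1, key _ σ h2, RingHom.id_apply, smul_smul]
    rfl
  · ext r
    change f ((r : V) • Z (ρ r)) = g r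
    have h2 : r = c r • ρ r := Subtype.ext (hρ r)
    conv_rhs => rw [h2, map_smul, ← hZ, ← map_smul, smul_smul, ← hρ r]

/-- Over a valuation ring, a localization of an injective module is injective as soon as it is
principally injective. -/
theorem injective_of_isPrincipallyInjective (hG : Module.Injective V G) (f : G →ₗ[V] M)
    [IsLocalizedModule S f] (hM : IsPrincipallyInjective V M) : Module.Injective V M := by
  refine Module.Baer.injective fun I g => ?_
  by_cases hI : ∀ r ∈ I, ∃ s ∈ S, s * r = 0
  · refine ⟨0, fun r hr => ?_⟩
    obtain ⟨s, hs, h⟩ := hI r hr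
    refine (IsLocalizedModule.smul_injective f ⟨s, hs⟩ ?_).symm
    have : s • (⟨r, hr⟩ : I) = 0 := Subtype.ext h
    change s • g ⟨r, hr⟩ = s • (0 : V →ₗ[V] M) r
    rw [← map_smul, this, map_zero, LinearMap.zero_apply, smul_zero]
  push Not at hI
  obtain ⟨r₀, hr₀I, hr₀⟩ := hI
  have hdiv : ∀ (g : I →ₗ[V] M) (r : I), ∃ y, (r : V) • y = g r := fun g r => hM _ _ fun a ha => by
    have : a • r = 0 := Subtype.ext ha
    rw [← map_smul, this, map_zero]
  -- Subtracting a multiplication, `g` may be assumed to vanish at `r₀`.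
  suffices H : ∀ g : I →ₗ[V] M, g ⟨r₀, hr₀I⟩ = 0 →
      ∃ h : V →ₗ[V] M, ∀ (x : V) (hx : x ∈ I), h x = g ⟨x, hx⟩ by
    obtain ⟨y, hy⟩ := hdiv g ⟨r₀, hr₀I⟩
    obtain ⟨h, hh⟩ := H (g - LinearMap.toSpanSingleton V M y ∘ₗ I.subtype) (by
      simp only [LinearMap.sub_apply, LinearMap.comp_apply, Submodule.subtype_apply,
        LinearMap.toSpanSingleton_apply]
      rw [← hy, sub_self])
    refine ⟨h + LinearMap.toSpanSingleton V M y, fun x hx => ?_⟩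
    rw [LinearMap.add_apply, hh x hx]
    simp
  intro g hg₀
  by_cases hI : ∃ r ∈ I, ∀ r' ∈ I, ∃ s ∈ S, r ∣ s * r'
  · obtain ⟨r, hr, h⟩ := hI
    obtain ⟨y, hy⟩ := hdiv g ⟨r, hr⟩
    refine ⟨LinearMap.toSpanSingleton V M y, fun x hx => ?_⟩
    obtain ⟨s, hs, a, ha⟩ := h x hx
    refine IsLocalizedModule.smul_injective f ⟨s, hs⟩ ?_
    change s • x • y = s • g ⟨x, hx⟩
    have h1 : s • (⟨x, hx⟩ : I) = a • ⟨r, hr⟩ := Subtype.ext (ha.trans (mul_comm _ _))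
    rw [← map_smul, h1, map_smul, ← hy, smul_smul, smul_smul, ha, mul_comm]
  push Not at hI
  have hPG := (IsFPInjective.of_injective hG).isPrincipallyInjective
  obtain ⟨h, hh⟩ := exists_lift_of_forall_not_dvd (S := S) f hI g (by
    intro r
    rcases ValuationRing.dvd_total (r : V) r₀ with ⟨e, he⟩ | ⟨e, he⟩
    · obtain ⟨y, hy⟩ := hdiv g r
      have h1 : (⟨r₀, hr₀I⟩ : I) = e • r := Subtype.ext (he.trans (mul_comm _ _))
      obtain ⟨z, rfl⟩ := exists_apply_eq_of_smul_eq_zero hPG f hr₀ (y := y) (by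
        rw [he, mul_comm, mul_smul, hy, ← map_smul, ← h1, hg₀])
      exact ⟨z, by rw [map_smul, hy]⟩
    · have h1 : r = e • (⟨r₀, hr₀I⟩ : I) := Subtype.ext (he.trans (mul_comm _ _))
      exact ⟨0, by rw [smul_zero, map_zero, h1, map_smul, hg₀, smul_zero]⟩)
  obtain ⟨k, hk⟩ := hG.out I.subtype I.subtype_injective h
  refine ⟨f ∘ₗ k, fun x hx => ?_⟩
  rw [LinearMap.comp_apply, ← hh, LinearMap.comp_apply]
  exact congrArg f (hk ⟨x, hx⟩)

omit [PreValuationRing V] in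
/-- Principal injectivity of `S⁻¹G` reduces to finding a common denominator: if `ann(r) z` vanishes
in `S⁻¹G`, a single `u ∈ S` should kill it. -/
theorem isPrincipallyInjective_of_exists_smul_eq_zero (hG : IsPrincipallyInjective V G)
    (f : G →ₗ[V] M) [IsLocalizedModule S f]
    (H : ∀ (r : V) (z : G), (∀ s ∈ S, s * r ≠ 0) →
      (∀ a t : V, t ∈ S → t * (a * r) = 0 → ∃ u ∈ S, u • a • z = 0) →
      ∃ u ∈ S, ∀ a : V, a * r = 0 → a • u • z = 0) : IsPrincipallyInjective V M := by
  intro r x hx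
  obtain ⟨⟨z, s⟩, hz⟩ := IsLocalizedModule.surj S f x
  have hz' : (s : V) • x = f z := hz
  by_cases hr : ∃ t ∈ S, t * r = 0
  · obtain ⟨t, ht, htr⟩ := hr
    exact ⟨0, IsLocalizedModule.smul_injective f ⟨t, ht⟩
      ((by rw [smul_zero, smul_zero] : t • r • (0 : M) = 0).trans (hx t htr).symm)⟩
  push Not at hr
  obtain ⟨u, hu, h⟩ := H r z hr fun a t ht h => by
    have h1 : f ((t * a) • z) = 0 := by
      rw [map_smul, ← hz', smul_comm, hx _ (by rw [mul_assoc, h]), smul_zero]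
    obtain ⟨v, hv⟩ := (IsLocalizedModule.eq_zero_iff S f).1 h1
    have hv' : (v : V) • (t * a) • z = 0 := hv
    exact ⟨v * t, S.mul_mem v.2 ht, by rwa [mul_smul, ← mul_smul t]⟩
  obtain ⟨y, hy⟩ := hG r (u • z) h
  obtain ⟨⟨y', hy'⟩⟩ : Nonempty {y' : M // (u * s) • y' = f y} :=
    ⟨⟨IsLocalizedModule.mk' f y (⟨u, hu⟩ * s), IsLocalizedModule.mk'_cancel' f y (⟨u, hu⟩ * s)⟩⟩
  refine ⟨y', IsLocalizedModule.smul_injective f (⟨u, hu⟩ * s) ?_⟩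
  change (u * (s : V)) • r • y' = (u * (s : V)) • x
  rw [smul_comm, hy', ← map_smul, hy, map_smul, ← hz', smul_smul]

/-- The localization theorem for valuation rings. The annihilators `ann(r)` are assumed to be
either all finitely generated, or, for `r ≠ 0`, not generated by one element up to
non-zero-divisors. -/
theorem injective_of_isLocalizedModule
    (hV : (∀ r : V, (Ideal.torsionOf V V r).FG) ∨ ∀ r : V, r ≠ 0 → ∀ a : V, a * r = 0 →
      ∃ b c : V, b * r = 0 ∧ c ∉ nonZeroDivisors V ∧ a = c * b)
    (hG : Module.Injective V G) (f : G →ₗ[V] M) [IsLocalizedModule S f] :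
    Module.Injective V M := by
  have hPG := (IsFPInjective.of_injective hG).isPrincipallyInjective
  refine injective_of_isPrincipallyInjective (S := S) hG f
    (isPrincipallyInjective_of_exists_smul_eq_zero (S := S) hPG f fun r z hr H => ?_)
  have hr0 : r ≠ 0 := fun h => hr 1 S.one_mem (by rw [h, mul_zero])
  rcases hV with hV | hV
  · obtain ⟨b, hb⟩ := PreValuationRing.exists_eq_span_singleton (hV r)
    have hbr : b * r = 0 := by
      have : b ∈ Ideal.torsionOf V V r := hb ▸ Ideal.mem_span_singleton_self b
      simpa using this
    obtain ⟨u, hu, h⟩ := H b 1 S.one_mem (by rw [hbr, mul_zero])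
    refine ⟨u, hu, fun a ha => ?_⟩
    have : a ∈ Ideal.span {b} := hb ▸ (by simpa using ha)
    obtain ⟨e, rfl⟩ := Ideal.mem_span_singleton.1 this
    rw [mul_comm, mul_smul, smul_comm b, h, smul_zero]
  by_cases hS : ∃ t ∈ S, t ∉ nonZeroDivisors V
  · -- Some `t ∈ S` is a zero divisor: an element `a` with `ar ≠ 0 = atr` dominates `ann(r)`.
    obtain ⟨t, ht, hts⟩ := hS
    obtain ⟨w, hw, hw0⟩ : ∃ w, t * w = 0 ∧ w ≠ 0 := by
      simpa [mem_nonZeroDivisors_iff_left] using hts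
    obtain ⟨a, rfl⟩ := (ValuationRing.dvd_total r w).resolve_right fun ⟨a, ha⟩ =>
      hr t ht (by rw [ha, ← mul_assoc, hw, zero_mul])
    obtain ⟨u, hu, h⟩ := H a t ht (by linear_combination hw)
    refine ⟨u, hu, fun a' ha' => ?_⟩
    obtain ⟨e, rfl⟩ := (ValuationRing.dvd_total a a').resolve_right fun ⟨e, he⟩ =>
      hw0 (by rw [he]; linear_combination e * ha')
    rw [mul_comm, mul_smul, smul_comm a, h, smul_zero]
  push Not at hS
  refine ⟨1, S.one_mem, fun a ha => ?_⟩
  rw [one_smul]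
  by_cases hJ : ∃ t ∈ nonZeroDivisors V, ∀ s ∈ S, ¬ t ∣ s
  · -- A non-zero-divisor `t` divisible by all of `S`: write `a = t b`.
    obtain ⟨t, ht, hts⟩ := hJ
    obtain ⟨b, rfl⟩ := (ValuationRing.dvd_total t a).resolve_right fun ⟨e, he⟩ =>
      hr0 ((mem_nonZeroDivisors_iff_left.1 ht) r (by rw [he]; linear_combination e * ha))
    obtain ⟨u, hu, h⟩ := H b 1 S.one_mem (by
      rw [one_mul]
      exact (mem_nonZeroDivisors_iff_left.1 ht) _ (by rw [← mul_assoc, ha]))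
    obtain ⟨e, rfl⟩ := PreValuationRing.dvd_of_forall_not_dvd hts hu
    rw [mul_right_comm, mul_comm, mul_smul, mul_smul, h, smul_zero]
  push Not at hJ
  obtain ⟨b, c, hb, hc, rfl⟩ := hV r hr0 a ha
  obtain ⟨u, hu, h⟩ := H b 1 S.one_mem (by rw [hb, mul_zero])
  obtain ⟨e, rfl⟩ := (ValuationRing.dvd_total u c).resolve_right fun ⟨e, he⟩ =>
    hc (mul_mem_nonZeroDivisors.1 (he ▸ hS u hu)).1
  rw [mul_right_comm, mul_comm, mul_smul, mul_smul, h, smul_zero]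

end Localization
/-! ### Coherent and semicoherent valuation rings -/

section Coherent

variable {V : Type u} [CommRing V] [PreValuationRing V]

theorem isCoherentCommRing_iff_torsionOf_fg :
    IsCoherentCommRing V ↔ ∀ r : V, (Ideal.torsionOf V V r).FG := by
  constructor
  · intro h r
    have := h (Ideal.span {r}) (Submodule.fg_span_singleton r)
    have h1 := Module.FinitePresentation.fg_ker
      ((Ideal.quotTorsionOfEquivSpanSingleton V V r).toLinearMap ∘ₗ (Ideal.torsionOf V V r).mkQ)
      ((Ideal.quotTorsionOfEquivSpanSingleton V V r).surjective.comp (Submodule.mkQ_surjective _))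
    rwa [LinearEquiv.ker_comp, Submodule.ker_mkQ] at h1
  · intro h I hI
    obtain ⟨r, rfl⟩ := PreValuationRing.exists_eq_span_singleton hI
    refine Module.finitePresentation_of_surjective
      ((Ideal.quotTorsionOfEquivSpanSingleton V V r).toLinearMap ∘ₗ (Ideal.torsionOf V V r).mkQ)
      ((Ideal.quotTorsionOfEquivSpanSingleton V V r).surjective.comp (Submodule.mkQ_surjective _)) ?_
    rw [LinearEquiv.ker_comp, Submodule.ker_mkQ]
    exact h r

/-- The double annihilator property `(0 : (0 : r)) = rQ` in the total ring of fractions `Q` of a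
valuation ring `V`, stated in `V`. -/
theorem exists_dvd_mul_of_annihilator_le {r b : V} (h : ∀ a, a * r = 0 → a * b = 0) :
    ∃ t ∈ nonZeroDivisors V, r ∣ t * b := by
  rcases ValuationRing.dvd_total r b with hrb | ⟨c, rfl⟩
  · exact ⟨1, Submonoid.one_mem _, by rwa [one_mul]⟩
  by_cases hc : c ∈ nonZeroDivisors V
  · exact ⟨c, hc, by rw [mul_comm]⟩
  obtain ⟨w, hw, hw0⟩ : ∃ w, c * w = 0 ∧ w ≠ 0 := by
    simpa [mem_nonZeroDivisors_iff_left] using hc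
  have hbc : b * c = 0 := by
    rcases ValuationRing.dvd_total w b with ⟨d, rfl⟩ | ⟨d, rfl⟩
    · linear_combination d * hw
    · exact absurd (by linear_combination h d (by linear_combination hw)) hw0
  have hb : b = 0 := by simpa using h 1 (by rw [hbc, mul_zero])
  exact ⟨1, Submonoid.one_mem _, by rw [hb, mul_zero]; exact dvd_zero _⟩

/-- If `V` is a semicoherent valuation ring with total ring of fractions `Q`, each `r` has an
`s` with `(0 : s) = rQ`. It comes from embedding into a flat module the quotient map
`E → E / rE ⊆ F`, where `E` is the injective hull of `V`: this map is killed exactly by the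
elements of `rQ`, and flatness makes it divisible by an element of `(0 : r)`. -/
theorem IsSemicoherentRing.exists_annihilator_eq (hV : IsSemicoherentRing V) (r : V) :
    ∃ s : V, s * r = 0 ∧ ∀ b, b * s = 0 → ∃ t ∈ nonZeroDivisors V, r ∣ t * b := by
  let E := InjectiveHull V V
  let rE : Submodule V E := LinearMap.range (LinearMap.lsmul V E r)
  let F := InjectiveHull V (E ⧸ rE)
  have hE := InjectiveHull.isInjectiveHull V V
  have hF := InjectiveHull.isInjectiveHull V (E ⧸ rE)
  obtain ⟨X, _, _, hX, φ, hφ⟩ := hV E F hE.injective_module hF.injective_module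
  let p : E →ₗ[V] F := InjectiveHull.ι V (E ⧸ rE) ∘ₗ rE.mkQ
  have hp : ∀ x, p x = 0 ↔ x ∈ rE := fun x => by
    rw [LinearMap.comp_apply, map_eq_zero_iff _ hF.injective_map, Submodule.mkQ_apply,
      Submodule.Quotient.mk_eq_zero]
  have hrp : r • p = 0 := LinearMap.ext fun x => by
    rw [LinearMap.smul_apply, ← map_smul]
    exact (hp _).2 ⟨x, rfl⟩
  have hrel : ∑ i : Fin 1, (fun _ => r) i • (fun _ => φ p) i = 0 := by
    rw [Fin.sum_univ_one, ← map_smul, hrp, map_zero]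
  obtain ⟨k, a, y, hy, ha⟩ := Module.Flat.isTrivialRelation_of_sum_smul_eq_zero hrel
  simp only [Fin.sum_univ_one] at ha
  obtain ⟨s, hs⟩ := PreValuationRing.exists_eq_span_singleton
    (I := Ideal.span (Set.range (a 0))) (Submodule.fg_span (Set.finite_range _))
  have hs' : ∀ j, s ∣ a 0 j := fun j => Ideal.mem_span_singleton.1 <| by
    rw [← hs]
    exact Ideal.subset_span ⟨j, rfl⟩
  have hsr : s * r = 0 := by
    have h1 : Ideal.span (Set.range (a 0)) ≤ Ideal.torsionOf V V r := by
      rw [Ideal.span_le]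
      rintro _ ⟨j, rfl⟩
      simpa [mul_comm] using ha j
    have := h1 (hs ▸ Ideal.mem_span_singleton_self s)
    simpa using this
  refine ⟨s, hsr, fun b hb => exists_dvd_mul_of_annihilator_le fun c hc => ?_⟩
  have hbp : b • p = 0 := hφ <| by
    have h2 : φ p = ∑ j, a 0 j • y j := hy 0
    rw [map_smul, h2, Finset.smul_sum, map_zero]
    refine Finset.sum_eq_zero fun j _ => ?_
    obtain ⟨e, he⟩ := hs' j
    rw [he, smul_smul, ← mul_assoc, hb, zero_mul, zero_smul]
  obtain ⟨x, hx⟩ : b • InjectiveHull.ι V V 1 ∈ rE := by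
    rw [← hp, map_smul]
    exact LinearMap.congr_fun hbp _
  have hx' : r • x = b • InjectiveHull.ι V V 1 := hx
  refine hE.injective_map ?_
  rw [← mul_one (c * b), ← smul_eq_mul, map_smul, mul_smul, ← hx', smul_smul, hc, zero_smul,
    map_zero]

/-- Two elements of a ring are annihilator partners if each generates the annihilator of the
other. -/
def IsAnnihilatorPair {Q : Type*} [CommRing Q] (r s : Q) : Prop :=
  (∀ a, a * r = 0 ↔ s ∣ a) ∧ ∀ a, a * s = 0 ↔ r ∣ a

section Pairs

theorem IsAnnihilatorPair.symm {Q : Type*} [CommRing Q] {r s : Q} (h : IsAnnihilatorPair r s) : IsAnnihilatorPair s r :=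
  ⟨h.2, h.1⟩

variable {Q : Type u} [CommRing Q] [PreValuationRing Q]

theorem isAnnihilatorPair_of_left (hQ : ∀ t ∈ nonZeroDivisors Q, IsUnit t) {r s : Q}
    (h : ∀ a, a * r = 0 ↔ s ∣ a) : IsAnnihilatorPair r s := by
  have hsr : s * r = 0 := (h s).2 dvd_rfl
  refine ⟨h, fun a => ⟨fun ha => ?_, ?_⟩⟩
  · obtain ⟨t, ht, hta⟩ := exists_dvd_mul_of_annihilator_le (r := r) (b := a) fun x hx => by
      obtain ⟨e, rfl⟩ := (h x).1 hx
      linear_combination e * ha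
    exact (hQ t ht).dvd_mul_left.1 hta
  · rintro ⟨e, rfl⟩
    linear_combination e * hsr

variable [Nontrivial Q]

theorem IsAnnihilatorPair.mul (hQ : ∀ t ∈ nonZeroDivisors Q, IsUnit t) {r s c d : Q}
    (h : IsAnnihilatorPair r s) (hs : s ≠ 0) (hd : s = c * d) : IsAnnihilatorPair (r * c) d := by
  have hsr : s * r = 0 := (h.1 s).2 dvd_rfl
  refine isAnnihilatorPair_of_left hQ fun a => ⟨fun ha => ?_, ?_⟩
  · rcases ValuationRing.dvd_total d a with hda | ⟨e, he⟩
    · exact hda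
    obtain ⟨x, hx⟩ := (h.1 (c * a)).1 (by linear_combination ha)
    have h1 : c * a * (1 - e * x) = 0 := by linear_combination hx + x * hd + x * c * he
    rcases IsLocalRing.isUnit_or_isUnit_one_sub_self (e * x) with h2 | h2
    · rw [he]
      exact (isUnit_of_mul_isUnit_left h2).mul_right_dvd.2 dvd_rfl
    · exact absurd (by rw [hd, he, ← mul_assoc, h2.mul_left_eq_zero.1 h1, zero_mul]) hs
  · rintro ⟨e, rfl⟩
    linear_combination e * hsr - e * r * hd

/-- Over a valuation ring equal to its total ring of fractions, one annihilator pair of nonzero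
elements provides every element with a partner. -/
theorem IsAnnihilatorPair.exists_partner (hQ : ∀ t ∈ nonZeroDivisors Q, IsUnit t) {r₀ s₀ : Q}
    (h : IsAnnihilatorPair r₀ s₀) (hr₀ : r₀ ≠ 0) (hs₀ : s₀ ≠ 0) (r : Q) :
    ∃ s, IsAnnihilatorPair r s := by
  have hsr : s₀ * r₀ = 0 := (h.1 s₀).2 dvd_rfl
  by_cases hr : r = 0
  · exact ⟨1, isAnnihilatorPair_of_left hQ fun a => by simp [hr]⟩
  rcases ValuationRing.dvd_total r₀ r with ⟨c, rfl⟩ | ⟨c, hc⟩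
  · obtain ⟨d, hd⟩ := (ValuationRing.dvd_total c s₀).resolve_right fun ⟨e, he⟩ =>
      hr (by rw [he]; linear_combination e * hsr)
    exact ⟨d, h.mul hQ hs₀ hd⟩
  by_cases hcs : c * s₀ = 0
  · -- Here `r` is a unit, with partner `0`.
    obtain ⟨e, he⟩ := (h.2 c).1 hcs
    have h1 : c * (1 - r * e) = 0 := by linear_combination he + e * hc
    have hru : IsUnit r := by
      rcases IsLocalRing.isUnit_or_isUnit_one_sub_self (r * e) with h2 | h2
      · exact isUnit_of_mul_isUnit_left h2
      · exact absurd (by rw [hc, h2.mul_left_eq_zero.1 h1, mul_zero]) hr₀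
    exact ⟨0, isAnnihilatorPair_of_left hQ fun a => by
      rw [hru.mul_left_eq_zero, zero_dvd_iff]⟩
  · exact ⟨s₀ * c, (h.symm.mul hQ hr₀ (by rw [hc, mul_comm])).symm⟩

open TensorProduct in
omit [Nontrivial Q] in
/-- If every element has an annihilator partner, injective modules are flat. -/
theorem flat_of_injective_of_exists_partner (hQ : ∀ r : Q, ∃ s, IsAnnihilatorPair r s)
    {W : Type u} [AddCommGroup W] [Module Q W] (hW : Module.Injective Q W) : Module.Flat Q W := by
  rw [Module.Flat.iff_lift_lsmul_comp_subtype_injective]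
  intro I hI
  obtain ⟨r, rfl⟩ := PreValuationRing.exists_eq_span_singleton hI
  let r' : Ideal.span {r} := ⟨r, Ideal.mem_span_singleton_self r⟩
  have hx : ∀ x : Ideal.span {r} ⊗[Q] W, ∃ w, x = r' ⊗ₜ w := fun x => by
    induction x with
    | zero => exact ⟨0, (tmul_zero _ _).symm⟩
    | tmul i w =>
      obtain ⟨c, hc⟩ := Ideal.mem_span_singleton.1 i.2
      have : i = c • r' := Subtype.ext (hc.trans (mul_comm _ _))
      exact ⟨c • w, by rw [this, smul_tmul]⟩
    | add x y hx hy =>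
      obtain ⟨w, rfl⟩ := hx
      obtain ⟨w', rfl⟩ := hy
      exact ⟨w + w', (tmul_add _ _ _).symm⟩
  rw [injective_iff_map_eq_zero]
  intro x h
  obtain ⟨w, rfl⟩ := hx x
  have hrw : r • w = 0 := h
  obtain ⟨s, hs⟩ := hQ r
  obtain ⟨y, rfl⟩ := (IsFPInjective.of_injective hW).isPrincipallyInjective s w fun a ha => by
    obtain ⟨e, rfl⟩ := (hs.2 a).1 ha
    rw [mul_comm, mul_smul, hrw, smul_zero]
  have : s • r' = 0 := Subtype.ext ((hs.1 s).2 dvd_rfl)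
  rw [← smul_tmul, this, zero_tmul]

end Pairs

instance FractionRing.preValuationRing : PreValuationRing (FractionRing V) := by
  rw [PreValuationRing.iff_dvd_total]
  refine ⟨fun x y => ?_⟩
  obtain ⟨⟨a, s⟩, ha⟩ := IsLocalization.surj (nonZeroDivisors V) x
  obtain ⟨⟨b, t⟩, hb⟩ := IsLocalization.surj (nonZeroDivisors V) y
  have hs := IsLocalization.map_units (FractionRing V) s
  have ht := IsLocalization.map_units (FractionRing V) t
  refine (ValuationRing.dvd_total a b).imp (fun h => ?_) fun h => ?_
  · rw [← hs.mul_right_dvd, ← ht.dvd_mul_right, ha, hb]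
    exact map_dvd _ h
  · rw [← ht.mul_right_dvd, ← hs.dvd_mul_right, ha, hb]
    exact map_dvd _ h

/-- If some `(0 : r₀)` with `r₀ ≠ 0` is generated by `a₀` up to non-zero-divisors, then `V` is
semicoherent: injective modules over the total ring of fractions `Q` are then flat, and
`Hom(E, F)`, having no torsion when `E` is injective, embeds into an injective `Q`-module. -/
theorem isSemicoherentRing_of_annihilator [Nontrivial V] {r₀ a₀ : V} (hr₀ : r₀ ≠ 0)
    (ha₀ : a₀ * r₀ = 0)
    (h : ∀ b c, b * r₀ = 0 → a₀ = c * b → c ∈ nonZeroDivisors V) : IsSemicoherentRing V := by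
  let Q := FractionRing V
  have hinj := IsFractionRing.injective V Q
  have hQ : ∀ t ∈ nonZeroDivisors Q, IsUnit t := fun t ht =>
    (IsFractionRing.nonZeroDivisors_eq_isUnit V (K := Q)).le ht
  have ha₀' : a₀ ≠ 0 := fun h0 => zero_notMem_nonZeroDivisors (h 0 0 (zero_mul _) (by simp [h0]))
  have hpair : IsAnnihilatorPair (algebraMap V Q r₀) (algebraMap V Q a₀) := by
    refine isAnnihilatorPair_of_left hQ fun x => ⟨fun hx => ?_, ?_⟩
    · obtain ⟨⟨b, t⟩, hb⟩ := IsLocalization.surj (nonZeroDivisors V) x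
      have ht : IsUnit (algebraMap V Q t) := IsLocalization.map_units Q t
      rw [← ht.dvd_mul_right, hb]
      have hbr : b * r₀ = 0 := hinj (by rw [map_mul, ← hb, mul_right_comm, hx]; simp)
      rcases ValuationRing.dvd_total a₀ b with hab | ⟨c, hc⟩
      · exact map_dvd _ hab
      · have := h b c hbr (by rw [hc, mul_comm])
        have : IsUnit (algebraMap V Q c) := IsLocalization.map_units Q ⟨c, this⟩
        rw [hc, map_mul]
        exact this.mul_right_dvd.2 dvd_rfl
    · rintro ⟨e, rfl⟩
      rw [mul_right_comm, ← map_mul, ha₀, map_zero, zero_mul]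
  have hQp := hpair.exists_partner hQ (by simpa using hr₀) (by simpa using ha₀')
  intro E F _ _ _ _ hE hF
  obtain ⟨W, ι, hW⟩ := exists_isInjectiveHull (R := Q)
    (LocalizedModule (nonZeroDivisors V) (E →ₗ[V] F))
  have hflat := flat_of_injective_of_exists_partner hQp hW.injective_module
  let _ : Module V W := Module.compHom W (algebraMap V Q)
  have _ : IsScalarTower V Q W := ⟨fun a q w => by
    rw [Algebra.smul_def, mul_smul]; rfl⟩
  refine ⟨W, inferInstance, inferInstance, Module.Flat.trans V Q W,
    ι.restrictScalars V ∘ₗ LocalizedModule.mkLinearMap (nonZeroDivisors V) (E →ₗ[V] F),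
    hW.injective_map.comp ?_⟩
  rw [injective_iff_map_eq_zero]
  intro φ hφ
  obtain ⟨t, ht⟩ := (IsLocalizedModule.eq_zero_iff (nonZeroDivisors V)
    (LocalizedModule.mkLinearMap (nonZeroDivisors V) (E →ₗ[V] F))).1 hφ
  ext x
  obtain ⟨y, rfl⟩ := (IsFPInjective.of_injective hE).isPrincipallyInjective (t : V) x fun a ha => by
    rw [(mem_nonZeroDivisors_iff_right.1 t.2) a ha, zero_smul]
  rw [map_smul]
  exact LinearMap.congr_fun ht y

/-- The dichotomy for valuation rings which makes localization preserve injectivity. -/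
theorem torsionOf_fg_or_exists_zeroDivisor [Nontrivial V]
    (h : IsCoherentCommRing V ∨ ¬ IsSemicoherentRing V) :
    (∀ r : V, (Ideal.torsionOf V V r).FG) ∨ ∀ r : V, r ≠ 0 → ∀ a : V, a * r = 0 →
      ∃ b c : V, b * r = 0 ∧ c ∉ nonZeroDivisors V ∧ a = c * b := by
  refine h.imp isCoherentCommRing_iff_torsionOf_fg.1 fun h r hr a ha => ?_
  by_contra! H
  exact h (isSemicoherentRing_of_annihilator hr ha fun b c hb hc => by
    by_contra hc'
    exact H b c hb hc' hc)

end Coherent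
/-! ### Change of rings and indecomposable injective modules -/

section ChangeOfRings

variable {R A : Type u} [CommRing R] [CommRing A] [Algebra R A] {N : Type u} [AddCommGroup N]
  [Module R N] [Module A N] [IsScalarTower R A N]

theorem injective_of_isLocalization (T : Submonoid R) [IsLocalization T A]
    (hN : Module.Injective R N) : Module.Injective A N := by
  refine Module.Baer.injective fun I g => ?_
  obtain ⟨h, hh⟩ := hN.out (I.subtype.restrictScalars R) I.subtype_injective (g.restrictScalars R)
  exact ⟨h.extendScalarsOfIsLocalization T A, fun x hx => hh ⟨x, hx⟩⟩

open TensorProduct in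
theorem injective_of_flat_algebra [Module.Flat R A] (hN : Module.Injective A N) :
    Module.Injective R N := by
  refine Module.Baer.injective fun I g => ?_
  obtain ⟨h, hh⟩ := hN.out (I.subtype.baseChange A)
    (Module.Flat.lTensor_preserves_injective_linearMap _ I.subtype_injective)
    (g.liftBaseChange A)
  refine ⟨h.restrictScalars R ∘ₗ TensorProduct.mk R A R 1, fun x hx => ?_⟩
  have := hh (1 ⊗ₜ ⟨x, hx⟩)
  simpa using this

end ChangeOfRings

section Indecomposable

variable {R : Type u} [CommRing R] {D : Type u} [AddCommGroup D] [Module R D]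

/-- Indecomposable injective modules are uniform. -/
theorem IsIndecomposableModule.inf_ne_bot (hD : IsIndecomposableModule R D)
    (hinj : Module.Injective R D) {A B : Submodule R D} (hA : A ≠ ⊥) (hB : B ≠ ⊥) :
    A ⊓ B ≠ ⊥ := by
  intro hAB
  obtain ⟨H, hAH, hess, hH⟩ := exists_essential_injective hinj A
  obtain ⟨π, hπ⟩ := hH.out H.subtype H.subtype_injective LinearMap.id
  rcases hD.2 _ _ (LinearMap.isCompl_of_proj hπ) with h | h
  · exact hA (eq_bot_iff.2 (h ▸ hAH))
  · have hHt : H = ⊤ := by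
      have := (LinearMap.isCompl_of_proj hπ).sup_eq_top
      rwa [h, sup_bot_eq] at this
    exact hB (hess B (hHt ▸ le_top) (inf_comm A B ▸ hAB))

/-- The elements of `R` acting with nonzero kernel on a uniform module form an ideal, and outside
any maximal ideal containing it `R` acts bijectively if the module is injective. -/
theorem IsIndecomposableModule.exists_isMaximal (hD : IsIndecomposableModule R D)
    (hinj : Module.Injective R D) :
    ∃ P : Ideal R, P.IsMaximal ∧ ∀ r ∉ P, Function.Bijective fun x : D => r • x := by
  have := hD.1
  obtain ⟨x₀, hx₀⟩ := exists_ne (0 : D)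
  let L : Ideal R :=
    { carrier := {r | ∃ x : D, x ≠ 0 ∧ r • x = 0}
      zero_mem' := ⟨x₀, hx₀, zero_smul _ _⟩
      add_mem' := by
        rintro a b ⟨x, hx, hax⟩ ⟨y, hy, hby⟩
        have h := hD.inf_ne_bot hinj (A := Submodule.span R {x}) (B := Submodule.span R {y})
          (by simpa using hx) (by simpa using hy)
        obtain ⟨z, ⟨hzx, hzy⟩, hz⟩ := Submodule.exists_mem_ne_zero_of_ne_bot h
        obtain ⟨c, rfl⟩ := Submodule.mem_span_singleton.1 hzx
        obtain ⟨d, hd⟩ := Submodule.mem_span_singleton.1 hzy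
        refine ⟨c • x, hz, ?_⟩
        rw [add_smul]
        nth_rewrite 2 [← hd]
        rw [smul_comm a, smul_comm b, hax, hby, smul_zero, smul_zero, add_zero]
      smul_mem' := by
        rintro c a ⟨x, hx, hax⟩
        exact ⟨x, hx, by rw [smul_eq_mul, mul_smul, hax, smul_zero]⟩ }
  have hL : L ≠ ⊤ := by
    rw [Ideal.ne_top_iff_one]
    rintro ⟨x, hx, h⟩
    exact hx (by rwa [one_smul] at h)
  obtain ⟨P, hP, hLP⟩ := L.exists_le_maximal hL
  refine ⟨P, hP, fun r hr => ?_⟩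
  have hker : ∀ x : D, r • x = 0 → x = 0 := fun x hx => by
    by_contra h
    exact hr (hLP ⟨x, h, hx⟩)
  refine ⟨fun x y hxy => sub_eq_zero.1 (hker _ (by rw [smul_sub]; exact sub_eq_zero.2 hxy)),
    fun x => (IsFPInjective.of_injective hinj).isPrincipallyInjective r x fun a ha => hker _ ?_⟩
  rw [smul_smul, mul_comm, ha, zero_smul]

theorem IsIndecomposableModule.of_linearEquiv {D' : Type u} [AddCommGroup D'] [Module R D']
    (e : D ≃ₗ[R] D') (hD : IsIndecomposableModule R D) : IsIndecomposableModule R D' := by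
  have := hD.1
  refine ⟨e.symm.toEquiv.nontrivial, fun A B hAB => ?_⟩
  refine (hD.2 _ _ ((Submodule.orderIsoMapComap e.symm).isCompl hAB)).imp ?_ ?_ <;>
  exact fun h => (map_eq_bot_iff (Submodule.orderIsoMapComap e.symm)).1 h

theorem IsUniserialRing.preValuationRing (h : IsUniserialRing R) : PreValuationRing R :=
  PreValuationRing.iff_ideal_total.2 ⟨h⟩

/-- Localizations of an indecomposable injective module over an arithmetical ring: the module is
a module over some `R_P`, so the theorem for valuation rings applies. -/
theorem IsIndecomposableModule.injective_localizedModule (hR : IsArithmeticalRing R)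
    (hcoh : ∀ (P : Ideal R) [P.IsMaximal], IsCoherentCommRing (Localization.AtPrime P) ∨
      ¬ IsSemicoherentRing (Localization.AtPrime P))
    (hD : IsIndecomposableModule R D) (hinj : Module.Injective R D) (S : Submonoid R) :
    Module.Injective R (LocalizedModule S D) := by
  obtain ⟨P, hP, hbij⟩ := hD.exists_isMaximal hinj
  let V := Localization.AtPrime P
  have : PreValuationRing V := (hR P).preValuationRing
  let D' := LocalizedModule P.primeCompl D
  have hmk : Function.Bijective (LocalizedModule.mkLinearMap P.primeCompl D) := by
    constructor
    · rw [injective_iff_map_eq_zero]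
      intro x hx
      obtain ⟨s, hs⟩ := (IsLocalizedModule.eq_zero_iff P.primeCompl _).1 hx
      exact (hbij s s.2).1 (hs.trans (smul_zero _).symm)
    · intro y
      obtain ⟨⟨x, s⟩, hx⟩ := IsLocalizedModule.surj P.primeCompl
        (LocalizedModule.mkLinearMap P.primeCompl D) y
      obtain ⟨x', rfl⟩ := (hbij s s.2).2 x
      exact ⟨x', IsLocalizedModule.smul_injective (LocalizedModule.mkLinearMap P.primeCompl D) s
        ((LinearMap.map_smul_of_tower _ _ _).symm.trans hx.symm)⟩
  let e : D ≃ₗ[R] D' := LinearEquiv.ofBijective _ hmk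
  have hD' : Module.Injective V D' :=
    injective_of_isLocalization P.primeCompl (injective_of_linearEquiv e hinj)
  let S' := Algebra.algebraMapSubmonoid V S
  have hM : Module.Injective V (LocalizedModule S' D') :=
    injective_of_isLocalizedModule (S := S') (torsionOf_fg_or_exists_zeroDivisor (hcoh P)) hD'
      (LocalizedModule.mkLinearMap S' D')
  have : IsLocalizedModule S ((LocalizedModule.mkLinearMap S' D').restrictScalars R) :=
    IsLocalizedModule.restrictScalars S _
  have : Module.Flat R V := IsLocalization.flat V P.primeCompl
  exact injective_of_linearEquiv
    (IsLocalizedModule.linearEquiv S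
      ((LocalizedModule.mkLinearMap S' D').restrictScalars R ∘ₗ e.toLinearMap)
      (LocalizedModule.mkLinearMap S D))
    (injective_of_flat_algebra (A := V) hM)

end Indecomposable

/-! ### Goldie dimension -/

section Goldie

variable {R : Type u} [CommRing R] {E : Type u} [AddCommGroup E] [Module R E]

/-- An injective module is its own injective hull. -/
theorem InjectiveHull.ι_bijective (hE : Module.Injective R E) :
    Function.Bijective (InjectiveHull.ι R E) := by
  have h := InjectiveHull.isInjectiveHull R E
  refine ⟨h.injective_map, LinearMap.range_eq_top.1 ?_⟩
  obtain ⟨π, hπ⟩ := hE.out _ h.injective_map LinearMap.id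
  have hker : LinearMap.ker π = ⊥ := h.essential _ <| by
    rw [eq_bot_iff]
    rintro _ ⟨hx, ⟨y, rfl⟩⟩
    have : y = 0 := (hπ y).symm.trans hx
    rw [this, map_zero]
    exact Submodule.zero_mem _
  rw [eq_top_iff]
  rintro x -
  exact ⟨π x, LinearMap.ker_eq_bot.1 hker (hπ (π x))⟩

theorem HasGoldieDimension.of_linearEquiv {E' : Type u} [AddCommGroup E'] [Module R E']
    (hE : Module.Injective R E) (e : E' ≃ₗ[R] E) {n : ℕ} {D : Fin n → Submodule R E'}
    (hD : DirectSum.IsInternal D)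
    (hDi : ∀ i, Module.Injective R (D i) ∧ IsIndecomposableModule R (D i)) :
    HasGoldieDimension R E n := by
  let e' : E' ≃ₗ[R] InjectiveHull R E :=
    e.trans (LinearEquiv.ofBijective _ (InjectiveHull.ι_bijective hE))
  rw [DirectSum.isInternal_submodule_iff_iSupIndep_and_iSup_eq_top] at hD
  refine ⟨fun i => (D i).map e'.toLinearMap, ?_, fun i =>
    ⟨injective_of_linearEquiv (e'.submoduleMap (D i)) (hDi i).1,
      (hDi i).2.of_linearEquiv (e'.submoduleMap (D i))⟩⟩
  rw [DirectSum.isInternal_submodule_iff_iSupIndep_and_iSup_eq_top]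
  refine ⟨hD.1.map_orderIso (Submodule.orderIsoMapComap e'), ?_⟩
  rw [← Submodule.map_iSup, hD.2, Submodule.map_top, LinearEquiv.range]

theorem HasFiniteGoldieDimension.injectiveHull {M : Type u} [AddCommGroup M] [Module R M]
    (hM : HasFiniteGoldieDimension R M) : HasFiniteGoldieDimension R (InjectiveHull R M) := by
  obtain ⟨n, D, hD, hDi⟩ := hM
  exact ⟨n, HasGoldieDimension.of_linearEquiv (InjectiveHull.isInjectiveHull R M).injective_module
    (LinearEquiv.refl R _) hD hDi⟩

theorem IsIndecomposableModule.hasFiniteGoldieDimension (hE : Module.Injective R E)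
    (h : IsIndecomposableModule R E) : HasFiniteGoldieDimension R E := by
  refine ⟨1, HasGoldieDimension.of_linearEquiv hE (LinearEquiv.refl R E) (D := fun _ => ⊤) ?_
    fun _ => ⟨injective_of_linearEquiv Submodule.topEquiv.symm hE,
      h.of_linearEquiv Submodule.topEquiv.symm⟩⟩
  rw [DirectSum.isInternal_submodule_iff_iSupIndep_and_iSup_eq_top]
  exact ⟨iSupIndep_subsingleton _, by simp⟩

theorem injective_localizedModule_of_hasFiniteGoldieDimension (S : Submonoid R)
    (h : ∀ (D : Type u) [AddCommGroup D] [Module R D], Module.Injective R D →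
      IsIndecomposableModule R D → Module.Injective R (LocalizedModule S D))
    (hE : Module.Injective R E) (hfin : HasFiniteGoldieDimension R E) :
    Module.Injective R (LocalizedModule S E) := by
  obtain ⟨n, D, hD, hDi⟩ := hfin
  have hinj : ∀ i, Module.Injective R (LocalizedModule S (D i)) := fun i =>
    h _ (hDi i).1 (hDi i).2
  let e₁ : E ≃ₗ[R] InjectiveHull R E := LinearEquiv.ofBijective _ (InjectiveHull.ι_bijective hE)
  let e₂ : (DirectSum (Fin n) fun i => D i) ≃ₗ[R] InjectiveHull R E :=
    LinearEquiv.ofBijective (DirectSum.coeLinearMap D) hD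
  let e : E ≃ₗ[R] ∀ i, D i :=
    e₁.trans (e₂.symm.trans (DirectSum.linearEquivFunOnFintype R (Fin n) fun i => D i))
  exact injective_of_linearEquiv
    (IsLocalizedModule.linearEquiv S
      (LinearMap.pi (fun i => LocalizedModule.mkLinearMap S (D i) ∘ₗ LinearMap.proj i) ∘ₗ
        e.toLinearMap)
      (LocalizedModule.mkLinearMap S E))
    (Module.Injective.pi R fun i => LocalizedModule S (D i))

/-- The injective hull of a simple module is indecomposable: its nonzero submodules all contain
the simple module. -/
theorem isIndecomposableModule_injectiveHull (P : Ideal R) [P.IsMaximal] :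
    IsIndecomposableModule R (InjectiveHull R (R ⧸ P)) := by
  have h := InjectiveHull.isInjectiveHull R (R ⧸ P)
  have : IsSimpleModule R (R ⧸ P) :=
    isSimpleModule_iff_quot_maximal.2 ⟨P, inferInstance, ⟨LinearEquiv.refl R _⟩⟩
  have hsimple : IsSimpleModule R (LinearMap.range (InjectiveHull.ι R (R ⧸ P))) :=
    IsSimpleModule.congr (LinearEquiv.ofInjective _ h.injective_map).symm
  have hatom := isSimpleModule_iff_isAtom.1 hsimple
  have hle : ∀ N : Submodule R (InjectiveHull R (R ⧸ P)), N ≠ ⊥ →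
      LinearMap.range (InjectiveHull.ι R (R ⧸ P)) ≤ N := fun N hN => by
    by_contra hc
    exact hN (h.essential N (disjoint_iff.1 (IsAtom.not_le_iff_disjoint hatom |>.1 hc).symm))
  refine ⟨h.injective_map.nontrivial, fun A B hAB => ?_⟩
  by_contra! hne
  exact hatom.1 (eq_bot_iff.2 (hAB.disjoint (hle A hne.1) (hle B hne.2)))

end Goldie
/-! ### Localization of FP-injective modules -/

section FPInjective

variable {R : Type u} [CommRing R]

/-- `S⁻¹G` is pure in `S⁻¹E` when `G` is an FP-injective submodule of `E`, so it is FP-injective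
if `S⁻¹E` is. -/
theorem IsFPInjective.localizedModule {G E : Type u} [AddCommGroup G] [Module R G]
    [AddCommGroup E] [Module R E] (S : Submonoid R) (hG : IsFPInjective R G) (j : G →ₗ[R] E)
    (hj : Function.Injective j) (hE : IsFPInjective R (LocalizedModule S E)) :
    IsFPInjective R (LocalizedModule S G) := by
  refine isFPInjective_of_exists_extend fun n K hK g => ?_
  have : Module.Finite R K := Module.Finite.iff_fg.2 hK
  let f := LocalizedModule.mkLinearMap S G
  let f' := LocalizedModule.mkLinearMap S E
  let J := IsLocalizedModule.map S f f' j
  obtain ⟨h, hh⟩ := hE.exists_extend K.subtype K.subtype_injective (J ∘ₗ g)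
  obtain ⟨m, p, hp⟩ := Module.Finite.exists_fin' R K
  -- Clear denominators in the solution `h` over `S⁻¹E` and in the constants of the system.
  obtain ⟨y, t, hy⟩ := Module.FinitePresentation.exists_lift_of_isLocalizedModule S f' h
  obtain ⟨c, s, hc⟩ := Module.FinitePresentation.exists_lift_of_isLocalizedModule S f (g ∘ₗ p)
  have hy' : ∀ v, f' (y v) = (t : R) • h v := LinearMap.congr_fun hy
  have hc' : ∀ v, f (c v) = (s : R) • g (p v) := LinearMap.congr_fun hc
  have hh' : ∀ v, h (p v) = J (g (p v)) := fun v => LinearMap.congr_fun hh (p v)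
  obtain ⟨u, hu⟩ := Module.Finite.exists_smul_of_comp_eq_of_isLocalizedModule S f'
    ((s : R) • y ∘ₗ K.subtype ∘ₗ p) ((t : R) • j ∘ₗ c) (by
      ext1 v
      ext
      simp only [LinearMap.comp_apply, LinearMap.smul_apply, map_smul, Submodule.subtype_apply]
      rw [hy', hh', ← IsLocalizedModule.map_apply S f f' j, hc', map_smul, smul_comm])
  have hu' : ∀ v, (u : R) • (s : R) • y (p v) = (u : R) • (t : R) • j (c v) :=
    LinearMap.congr_fun hu
  obtain ⟨z, hz⟩ := hG.exists_solution j hj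
    (fun i : Fin m => ((u : R) * s) • (p (Pi.single i 1) : Fin n → R))
    (fun i => ((u : R) * t) • c (Pi.single i 1)) y (fun i => by
      rw [map_smul, map_smul, mul_smul, mul_smul, hu'])
  have hz' : ((u : R) * s) • z ∘ₗ K.subtype ∘ₗ p = ((u : R) * t) • c := by
    ext i
    simpa using hz i
  let τ := (IsLocalizedModule.map_units f t).unit⁻¹
  have hτ : ∀ x, (t : R) • (τ : Module.End R _) x = x := fun x =>
    LinearMap.congr_fun (IsLocalizedModule.map_units f t).mul_val_inv x
  refine ⟨τ.val ∘ₗ f ∘ₗ z, LinearMap.ext fun x => ?_⟩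
  obtain ⟨v, rfl⟩ := hp x
  refine IsLocalizedModule.smul_injective f (u * s * t) ?_
  change ((u : R) * s * t) • τ.val (f (z (p v))) = ((u : R) * s * t) • g (p v)
  rw [mul_smul, hτ, ← map_smul, show ((u : R) * s) • z (p v) = ((u : R) * t) • c v from
    LinearMap.congr_fun hz' v, map_smul, hc', smul_smul]
  congr 1
  ring

end FPInjective

/-! ### Tensoring with the total ring of fractions of a local ring -/

section Fractions

variable {R : Type u} [CommRing R]

/-- The elements of `R` whose image in `R_P` is not a zero divisor. -/
def nonZeroDivisorsAtPrime (P : Ideal R) [P.IsPrime] : Submonoid R :=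
  (nonZeroDivisors (Localization.AtPrime P)).comap (algebraMap R (Localization.AtPrime P))

instance isLocalizedModule_fractionRing_tensorProduct (P : Ideal R) [P.IsPrime] (E : Type u)
    [AddCommGroup E] [Module R E] : IsLocalizedModule (nonZeroDivisorsAtPrime P)
      (TensorProduct.mk R (FractionRing (Localization.AtPrime P)) E 1) := by
  have : IsLocalization (nonZeroDivisorsAtPrime P) (FractionRing (Localization.AtPrime P)) :=
    IsLocalization.localization_localization_isLocalization_of_has_all_units P.primeCompl
      (nonZeroDivisors (Localization.AtPrime P)) (FractionRing (Localization.AtPrime P))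
      fun _ hx => hx.mem_nonZeroDivisors
  rw [isLocalizedModule_iff_isBaseChange (nonZeroDivisorsAtPrime P)
    (FractionRing (Localization.AtPrime P))]
  exact TensorProduct.isBaseChange _ _ _

/-- Suppose `E` contains a copy of `R / P`, generated by `x₀`, and that both `E` and its
localization at the non-zero-divisors of `R_P` are principally injective. If the valuation ring
`R_P` is semicoherent, then it is coherent. Otherwise there are a zero divisor `r ≠ 0` with
annihilator partner `s` and a non-zero-divisor `p ∈ P`; writing `x₀ = r x`, the element `p r`
kills `x`, so `x` is divisible by `s` up to a non-zero-divisor `t`, whence `x₀`, a multiple of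
`(r / t) s`, vanishes. -/
theorem isCoherentCommRing_of_isPrincipallyInjective (P : Ideal R) [P.IsMaximal]
    [PreValuationRing (Localization.AtPrime P)]
    (hsemi : IsSemicoherentRing (Localization.AtPrime P)) {E M : Type u} [AddCommGroup E]
    [Module R E] [AddCommGroup M] [Module R M] (f : E →ₗ[R] M)
    [IsLocalizedModule (nonZeroDivisorsAtPrime P) f] (hE : IsPrincipallyInjective R E)
    (hM : IsPrincipallyInjective R M) {x₀ : E} (hx₀ : x₀ ≠ 0) (hPx₀ : ∀ p ∈ P, p • x₀ = 0) :
    IsCoherentCommRing (Localization.AtPrime P) := by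
  set V := Localization.AtPrime P
  have hunit : ∀ {a : R}, a ∉ P → IsUnit (algebraMap R V a) := fun {a} ha =>
    IsLocalization.map_units V (⟨a, ha⟩ : P.primeCompl)
  have hann : ∀ a : R, a • x₀ = 0 → a ∈ P := fun a ha => by
    by_contra haP
    obtain ⟨b, i, hi, hbi⟩ := Ideal.IsMaximal.exists_inv ‹P.IsMaximal› haP
    exact hx₀ (by rw [← one_smul R x₀, ← hbi, add_smul, mul_smul, ha, hPx₀ i hi]; simp)
  have hlift : ∀ v : V, ∃ a u : R, u ∉ P ∧ v * algebraMap R V u = algebraMap R V a := fun v =>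
    let ⟨⟨a, u⟩, h⟩ := IsLocalization.surj P.primeCompl v
    ⟨a, u, u.2, h⟩
  have heq : ∀ {a b : R}, algebraMap R V a = algebraMap R V b → ∃ w ∉ P, w * a = w * b :=
    fun h => let ⟨w, hw⟩ := (IsLocalization.eq_iff_exists P.primeCompl V).1 h
    ⟨w, w.2, hw⟩
  have hS : ∀ {a : R}, a ∉ P → a ∈ nonZeroDivisorsAtPrime P := fun ha =>
    (hunit ha).mem_nonZeroDivisors
  have hpartner := hsemi.exists_annihilator_eq
  rw [isCoherentCommRing_iff_torsionOf_fg]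
  by_cases hu : ∀ t ∈ nonZeroDivisors V, IsUnit t
  · intro r
    obtain ⟨s, hsr, hs⟩ := hpartner r
    suffices Ideal.torsionOf V V r = Ideal.span {s} from this ▸ Submodule.fg_span_singleton s
    ext a
    rw [Ideal.mem_torsionOf_iff, Ideal.mem_span_singleton, smul_eq_mul]
    constructor
    · intro ha
      obtain ⟨t, ht, hta⟩ := exists_dvd_mul_of_annihilator_le (r := s) (b := a) fun b hb => by
        obtain ⟨t, ht, e, he⟩ := hs b hb
        exact (mem_nonZeroDivisors_iff_left.1 ht) _ (by linear_combination a * he + e * ha)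
      exact (hu t ht).dvd_mul_left.1 hta
    · rintro ⟨e, rfl⟩
      linear_combination e * hsr
  push Not at hu
  obtain ⟨p', hp', hpu⟩ := hu
  intro r'
  by_contra hr'
  have hr'0 : r' ≠ 0 := by
    rintro rfl
    have h0 : Ideal.torsionOf V V (0 : V) = ⊤ := by
      ext
      simp
    exact hr' (h0 ▸ Module.Finite.fg_top)
  have hr'z : r' ∉ nonZeroDivisors V := fun h => by
    suffices Ideal.torsionOf V V r' = ⊥ from hr' (this ▸ Submodule.fg_bot)
    ext a
    simpa [Ideal.mem_torsionOf_iff] using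
      ⟨mem_nonZeroDivisors_iff_right.1 h a, fun h => by rw [h, zero_mul]⟩
  obtain ⟨r, ur, hur, hr⟩ := hlift r'
  have hr0 : algebraMap R V r ≠ 0 := by
    rwa [← hr, Ne, (hunit hur).mul_left_eq_zero]
  have hrz : algebraMap R V r ∉ nonZeroDivisors V := fun h =>
    hr'z (mul_mem_nonZeroDivisors.1 (hr ▸ h)).1
  obtain ⟨s', hs'r, hs'⟩ := hpartner (algebraMap R V r)
  obtain ⟨s, us, hus, hs⟩ := hlift s'
  obtain ⟨p, up, hup, hp⟩ := hlift p'
  have hpS : p ∈ nonZeroDivisorsAtPrime P := by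
    change algebraMap R V p ∈ nonZeroDivisors V
    rw [← hp]
    exact mul_mem hp' (hunit hup).mem_nonZeroDivisors
  have hpP : p ∈ P := by
    by_contra h
    exact hpu (isUnit_of_mul_isUnit_left (hp ▸ hunit h))
  obtain ⟨x, rfl⟩ := hE r x₀ fun a ha => by
    by_cases haP : a ∈ P
    · exact hPx₀ a haP
    · refine absurd ?_ hr0
      rw [← (hunit haP).mul_right_eq_zero, ← map_mul, ha, map_zero]
  obtain ⟨y, hy⟩ := hM s (f x) fun a ha => by
    obtain ⟨t', ht', e', he⟩ := hs' (algebraMap R V a) (by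
      rw [← (hunit hus).mul_left_eq_zero, mul_assoc, hs, ← map_mul, ha, map_zero])
    obtain ⟨t, ut, hut, ht⟩ := hlift t'
    obtain ⟨e, ue, hue, he'⟩ := hlift e'
    obtain ⟨w, hw, hwe⟩ := heq (a := t * ue * a) (b := r * e * ut) (by
      simp only [map_mul, ← ht, ← he']
      linear_combination algebraMap R V ut * algebraMap R V ue * he)
    have htS : t ∈ nonZeroDivisorsAtPrime P := by
      change algebraMap R V t ∈ nonZeroDivisors V
      rw [← ht]
      exact mul_mem ht' (hunit hut).mem_nonZeroDivisors
    refine IsLocalizedModule.smul_injective f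
      (⟨p, hpS⟩ * (⟨w, hS hw⟩ * (⟨t, htS⟩ * ⟨ue, hS hue⟩)) : nonZeroDivisorsAtPrime P) ?_
    change (p * (w * (t * ue))) • a • f x = (p * (w * (t * ue))) • (0 : M)
    rw [smul_smul, smul_zero, show p * (w * (t * ue)) * a = w * e * ut * (p * r) by
      linear_combination p * hwe, mul_smul, mul_smul p, ← map_smul, ← map_smul, hPx₀ p hpP,
      map_zero, smul_zero]
  obtain ⟨⟨y', t₁⟩, hy'⟩ := IsLocalizedModule.surj (nonZeroDivisorsAtPrime P) f y
  have hy'' : (t₁ : R) • y = f y' := hy'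
  obtain ⟨t₂, ht₂⟩ := (IsLocalizedModule.eq_iff_exists (nonZeroDivisorsAtPrime P) f
    (x₁ := (t₁ : R) • x) (x₂ := s • y')).1 (by
      rw [map_smul, map_smul, ← hy'', ← hy, smul_comm])
  have htx : ((t₂ : R) * t₁) • x = (t₂ * s) • y' := by
    rw [mul_smul, mul_smul]
    exact ht₂
  have htV : algebraMap R V (t₂ * t₁) ∈ nonZeroDivisors V := (t₂ * t₁).2
  obtain ⟨q', hq'⟩ := (ValuationRing.dvd_total (algebraMap R V (t₂ * t₁))
    (algebraMap R V r)).resolve_right fun ⟨e, he⟩ => hrz (mul_mem_nonZeroDivisors.1 (he ▸ htV)).1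
  obtain ⟨q, uq, huq, hq⟩ := hlift q'
  obtain ⟨w, hw, hwq⟩ := heq (a := r * uq) (b := t₂ * t₁ * q) (by
    rw [map_mul, hq', map_mul _ (_ * _) q, ← hq, mul_assoc])
  obtain ⟨w', hw', hwq'⟩ := heq (a := s * q) (b := 0) (by
    rw [map_mul, map_zero, ← hs, ← hq]
    refine (mem_nonZeroDivisors_iff_left.1 htV) _ ?_
    linear_combination algebraMap R V us * algebraMap R V uq * (hs'r - s' * hq'))
  have hmem : w' * w * uq ∈ P := hann _ <| by
    rw [smul_smul, show w' * w * uq * r = w' * w * q * (t₂ * t₁) by linear_combination w' * hwq,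
      mul_smul, htx, smul_smul, show w' * w * q * (t₂ * s) = 0 by
        linear_combination w * t₂ * hwq', zero_smul]
  exact ((Ideal.IsMaximal.isPrime ‹_›).mul_mem_iff_mem_or_mem.1 hmem).elim
    (fun h => ((Ideal.IsMaximal.isPrime ‹_›).mul_mem_iff_mem_or_mem.1 h).elim hw' hw) huq

end Fractions

theorem theoremT (R : Type u) [CommRing R] (hR : IsArithmeticalRing R) :
    List.TFAE [
      ∀ (P : Ideal R) [P.IsMaximal],
        IsCoherentCommRing (Localization.AtPrime P) ∨
          ¬ IsSemicoherentRing (Localization.AtPrime P),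
      ∀ (S : Submonoid R) (G : Type u) [AddCommGroup G] [Module R G],
        Module.Injective R G → HasFiniteGoldieDimension R G →
          Module.Injective R (LocalizedModule S G),
      ∀ (S : Submonoid R) (G : Type u) [AddCommGroup G] [Module R G],
        IsFPInjective R G → HasFiniteGoldieDimension R G →
          IsFPInjective R (LocalizedModule S G),
      ∀ (P : Ideal R) [P.IsMaximal],
        IsFPInjective R
          (TensorProduct R (FractionRing (Localization.AtPrime P)) (InjectiveHull R (R ⧸ P)))] := by
  tfae_have 1 → 2 := fun h S G _ _ hG hfin =>
    injective_localizedModule_of_hasFiniteGoldieDimension S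
      (fun _ _ _ hinj hD => hD.injective_localizedModule hR h hinj S) hG hfin
  tfae_have 2 → 3 := fun h S G _ _ hG hfin =>
    hG.localizedModule S (InjectiveHull.ι R G) (InjectiveHull.isInjectiveHull R G).injective_map
      (.of_injective (h S _ (InjectiveHull.isInjectiveHull R G).injective_module
        hfin.injectiveHull))
  tfae_have 3 → 4 := fun h P _ => by
    have hE := (InjectiveHull.isInjectiveHull R (R ⧸ P)).injective_module
    exact (h (nonZeroDivisorsAtPrime P) _ (.of_injective hE)
      ((isIndecomposableModule_injectiveHull P).hasFiniteGoldieDimension hE)).of_linearEquiv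
        (IsLocalizedModule.iso (nonZeroDivisorsAtPrime P) (TensorProduct.mk R _ _ 1))
  tfae_have 4 → 1 := fun h P _ => by
    have hE := InjectiveHull.isInjectiveHull R (R ⧸ P)
    have : PreValuationRing (Localization.AtPrime P) := (hR P).preValuationRing
    refine or_iff_not_imp_right.2 fun hsemi => ?_
    refine isCoherentCommRing_of_isPrincipallyInjective P (not_not.1 hsemi)
      (TensorProduct.mk R (FractionRing (Localization.AtPrime P)) _ 1)
      (IsFPInjective.of_injective hE.injective_module).isPrincipallyInjective
      (h P).isPrincipallyInjective
      (x₀ := InjectiveHull.ι R (R ⧸ P) 1) ?_ fun p hp => ?_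
    · rw [Ne, map_eq_zero_iff _ hE.injective_map]
      exact one_ne_zero
    · rw [← map_smul, Algebra.smul_def, mul_one, Ideal.Quotient.algebraMap_eq,
        Ideal.Quotient.eq_zero_iff_mem.2 hp, map_zero]
  tfae_finish
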